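/- Let $A_1,\dots,A_n\subset\mathbb{R}^n$ be compact convex sets with nonempty interiors. For $\mathbf{u}=(u,u_{n+1})\in S^n=\{\mathbf{u}\in\mathbb{R}^{n}\times\mathbb{R} : \|\mathbf{u}\|=1\}$, with $u\in\mathbb{R}^n$ and $u_{n+1}\in\mathbb{R}$, put $$H_{\mathbf{u}}^+=\{x\in\mathbb{R}^n : \langle u,x\rangle\ge u_{n+1}\},\qquad H_{\mathbf{u}}^-=\{x\in\mathbb{R}^n : \langle u,x\rangle\le u_{n+1}\},$$ where $\langle\cdot,\cdot\rangle$ is the standard inner product, and for a nonempty compact set $X\subset\mathbb{R}^n$ put $\delta^*(u\mid X)=\max_{x\in X}\langle u,x\rangle$ and $\delta_*(u\mid X)=\min_{x\in X}\langle u,x\rangle$. Then there exists $\mathbf{u}=(u,u_{n+1})\in S^n$ such that, for all $i=1,\dots,n$ simultaneously, both $A_i\cap H_{\mathbf{u}}^+$ and $A_i\cap H_{\mathbf{u}}^-$ are nonempty and $$\delta^*(u\mid A_i\cap H_{\mathbf{u}}^+)-\delta_*(u\mid A_i\cap H_{\mathbf{u}}^+)=\delta^*(u\mid A_i\cap H_{\mathbf{u}}^-)-\delta_*(u\mid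 A_i\cap H_{\mathbf{u}}^-).$$ -/

import Mathlib

namespace BUOpt

/-- The first `n` coordinates `u ∈ ℝⁿ` of `𝐮 = (u, u_{n+1}) ∈ ℝⁿ⁺¹`. -/
noncomputable def normal {n : ℕ} (U : EuclideanSpace ℝ (Fin (n + 1))) :
    EuclideanSpace ℝ (Fin n) :=
  WithLp.toLp 2 (fun j => U j.castSucc)

/-- The last coordinate `u_{n+1}` of `𝐮 = (u, u_{n+1}) ∈ ℝⁿ⁺¹`. -/
noncomputable def level {n : ℕ} (U : EuclideanSpace ℝ (Fin (n + 1))) : ℝ :=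
  U (Fin.last n)

/-- The set `H⁺ = {x ∈ ℝⁿ | ⟨u, x⟩ ≥ u_{n+1}}`. -/
def upperHalf {n : ℕ} (U : EuclideanSpace ℝ (Fin (n + 1))) :
    Set (EuclideanSpace ℝ (Fin n)) :=
  {x | level U ≤ inner ℝ (normal U) x}

/-- The set `H⁻ = {x ∈ ℝⁿ | ⟨u, x⟩ ≤ u_{n+1}}`. -/
def lowerHalf {n : ℕ} (U : EuclideanSpace ℝ (Fin (n + 1))) :
    Set (EuclideanSpace ℝ (Fin n)) :=
  {x | inner ℝ (normal U) x ≤ level U}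

/-- The support function `δ*(u | X)`. On a nonempty compact set the supremum is a maximum,
see `isGreatest_upperSupport`. -/
noncomputable def upperSupport {n : ℕ} (u : EuclideanSpace ℝ (Fin n))
    (X : Set (EuclideanSpace ℝ (Fin n))) : ℝ :=
  sSup ((fun x => inner ℝ u x) '' X)

/-- The infimum support function `δ_*(u | X)`. On a nonempty compact set the infimum is a
minimum, see `isLeast_lowerSupport`. -/
noncomputable def lowerSupport {n : ℕ} (u : EuclideanSpace ℝ (Fin n))
    (X : Set (EuclideanSpace ℝ (Fin n))) : ℝ :=
  sInf ((fun x => inner ℝ u x) '' X)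

theorem isGreatest_upperSupport {n : ℕ} (u : EuclideanSpace ℝ (Fin n))
    {X : Set (EuclideanSpace ℝ (Fin n))} (hX : IsCompact X) (hne : X.Nonempty) :
    IsGreatest ((fun x => inner ℝ u x) '' X) (upperSupport u X) :=
  (hX.image (by fun_prop)).isGreatest_sSup (hne.image _)

theorem isLeast_lowerSupport {n : ℕ} (u : EuclideanSpace ℝ (Fin n))
    {X : Set (EuclideanSpace ℝ (Fin n))} (hX : IsCompact X) (hne : X.Nonempty) :
    IsLeast ((fun x => inner ℝ u x) '' X) (lowerSupport u X) :=
  (hX.image (by fun_prop)).isLeast_sInf (hne.image _)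

theorem isClosed_upperHalf {n : ℕ} (U : EuclideanSpace ℝ (Fin (n + 1))) :
    IsClosed (upperHalf U) :=
  isClosed_le (by fun_prop) (by fun_prop)

theorem isClosed_lowerHalf {n : ℕ} (U : EuclideanSpace ℝ (Fin (n + 1))) :
    IsClosed (lowerHalf U) :=
  isClosed_le (by fun_prop) (by fun_prop)

end BUOpt

namespace BUOpt

/-! ### Chains of vertex lists with coefficients modulo two -/

/-- Simplicial chains modulo two; a simplex is the list of its vertices. -/
abbrev Chain (E : Type*) := List E →₀ ZMod 2

namespace Chain

variable {E E' : Type*}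

/-- The linear extension of a map defined on simplices. -/
noncomputable def lift {M : Type*} [AddCommGroup M] [Module (ZMod 2) M] (F : List E → M) :
    Chain E →ₗ[ZMod 2] M :=
  Finsupp.linearCombination (ZMod 2) F

@[simp] theorem lift_single {M : Type*} [AddCommGroup M] [Module (ZMod 2) M] (F : List E → M)
    (l : List E) : lift F (Finsupp.single l 1) = F l := by
  simp [lift]

theorem linearMap_ext {M : Type*} [AddCommGroup M] [Module (ZMod 2) M]
    {S T : Chain E →ₗ[ZMod 2] M}
    (h : ∀ l, S (Finsupp.single l 1) = T (Finsupp.single l 1)) : S = T :=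
  Finsupp.lhom_ext' fun l => LinearMap.ext_ring (h l)

theorem add_self (c : Chain E) : c + c = 0 := by
  ext l
  exact CharTwo.add_self_eq_zero _

/-- The chain `c` is supported on simplices with property `p`. -/
def On (p : List E → Prop) (c : Chain E) : Prop :=
  c ∈ Finsupp.supported (ZMod 2) (ZMod 2) {l | p l}

theorem on_single {p : List E → Prop} {l : List E} (h : p l) :
    On p (Finsupp.single l 1) :=
  Finsupp.single_mem_supported _ _ h

theorem On.add {p : List E → Prop} {c d : Chain E} (hc : On p c) (hd : On p d) : On p (c + d) :=
  Submodule.add_mem _ hc hd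

theorem on_sum {ι : Type*} {p : List E → Prop} {s : Finset ι} {c : ι → Chain E}
    (h : ∀ i ∈ s, On p (c i)) : On p (∑ i ∈ s, c i) :=
  Submodule.sum_mem _ h

theorem On.mono {p q : List E → Prop} {c : Chain E} (hc : On p c) (h : ∀ l, p l → q l) : On q c :=
  Finsupp.supported_mono (fun l hl => h l hl) hc

theorem On.map_mem {M : Type*} [AddCommGroup M] [Module (ZMod 2) M] {p : List E → Prop}
    {c : Chain E} (hc : On p c) (T : Chain E →ₗ[ZMod 2] M) (N : Submodule (ZMod 2) M)
    (h : ∀ l, p l → T (Finsupp.single l 1) ∈ N) : T c ∈ N := by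
  have hle : Finsupp.supported (ZMod 2) (ZMod 2) {l | p l} ≤ N.comap T := by
    rw [Finsupp.supported_eq_span_single, Submodule.span_le]
    rintro _ ⟨l, hl, rfl⟩
    exact h l hl
  exact hle hc

theorem On.map {p : List E → Prop} {q : List E' → Prop} {c : Chain E} (hc : On p c)
    (T : Chain E →ₗ[ZMod 2] Chain E') (h : ∀ l, p l → On q (T (Finsupp.single l 1))) :
    On q (T c) :=
  hc.map_mem T _ h

theorem On.eq_of_single {M : Type*} [AddCommGroup M] [Module (ZMod 2) M] {p : List E → Prop}
    {c : Chain E} (hc : On p c) (S T : Chain E →ₗ[ZMod 2] M)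
    (h : ∀ l, p l → S (Finsupp.single l 1) = T (Finsupp.single l 1)) : S c = T c := by
  have := hc.map_mem (S - T) ⊥ fun l hl => by simp [h l hl]
  simpa [sub_eq_zero] using this

/-- The cone over a chain with apex `x`. -/
noncomputable def cone (x : E) : Chain E →ₗ[ZMod 2] Chain E :=
  lift fun l => Finsupp.single (x :: l) 1

/-- The chain map induced by a map of vertices. -/
noncomputable def push (g : E → E') : Chain E →ₗ[ZMod 2] Chain E' :=
  lift fun l => Finsupp.single (l.map g) 1

@[simp] theorem cone_single (x : E) (l : List E) :
    cone x (Finsupp.single l 1) = Finsupp.single (x :: l) 1 := by simp [cone]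

@[simp] theorem push_single (g : E → E') (l : List E) :
    push g (Finsupp.single l 1) = Finsupp.single (l.map g) 1 := by simp [push]

theorem push_cone (g : E → E') (x : E) (c : Chain E) :
    push g (cone x c) = cone (g x) (push g c) := by
  have : (push g).comp (cone x) = (cone (g x)).comp (push g) := linearMap_ext fun l => by simp
  exact LinearMap.congr_fun this c

theorem push_push {E'' : Type*} (g : E → E') (g' : E' → E'') (c : Chain E) :
    push g' (push g c) = push (g' ∘ g) c := by
  have : (push g').comp (push g) = push (g' ∘ g) := linearMap_ext fun l => by simp
  exact LinearMap.congr_fun this c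

/-- The (augmented) boundary of a simplex. -/
noncomputable def faces : List E → Chain E
  | [] => 0
  | x :: l => Finsupp.single l 1 + cone x (faces l)

/-- The (augmented) boundary operator. -/
noncomputable def bdry : Chain E →ₗ[ZMod 2] Chain E := lift faces

@[simp] theorem bdry_single_nil : bdry (Finsupp.single ([] : List E) 1) = 0 := by
  simp [bdry, faces]

@[simp] theorem bdry_single_cons (x : E) (l : List E) :
    bdry (Finsupp.single (x :: l) 1) =
      Finsupp.single l 1 + cone x (bdry (Finsupp.single l 1)) := by
  simp [bdry, faces]

theorem bdry_cone (x : E) (c : Chain E) : bdry (cone x c) = c + cone x (bdry c) := by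
  have : bdry.comp (cone x) = LinearMap.id + (cone x).comp bdry := linearMap_ext fun l => by simp
  exact LinearMap.congr_fun this c

theorem bdry_push (g : E → E') (c : Chain E) : bdry (push g c) = push g (bdry c) := by
  have : bdry.comp (push g) = (push g).comp bdry := linearMap_ext fun l => by
    induction l with
    | nil => simp
    | cons x l ih =>
      simp only [LinearMap.comp_apply, push_single] at ih ⊢
      simp [push_cone, ih]
  exact LinearMap.congr_fun this c

/-- The prism between the images of a simplex under two maps of vertices. -/
noncomputable def prismList (f g : E → E') : List E → Chain E'
  | [] => 0
  | x :: l => Finsupp.single (f x :: g x :: l.map g) 1 + cone (f x) (prismList f g l)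

/-- The prism operator of two maps of vertices. -/
noncomputable def prism (f g : E → E') : Chain E →ₗ[ZMod 2] Chain E' := lift (prismList f g)

@[simp] theorem prism_single_nil (f g : E → E') :
    prism f g (Finsupp.single ([] : List E) 1) = 0 := by
  simp [prism, prismList]

@[simp] theorem prism_single_cons (f g : E → E') (x : E) (l : List E) :
    prism f g (Finsupp.single (x :: l) 1) =
      Finsupp.single (f x :: g x :: l.map g) 1 + cone (f x) (prism f g (Finsupp.single l 1)) := by
  simp [prism, prismList]

theorem prism_cone (f g : E → E') (x : E) (c : Chain E) :
    prism f g (cone x c) = cone (f x) (cone (g x) (push g c)) + cone (f x) (prism f g c) := by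
  have : (prism f g).comp (cone x) =
      (cone (f x)).comp ((cone (g x)).comp (push g)) + (cone (f x)).comp (prism f g) :=
    linearMap_ext fun l => by simp
  exact LinearMap.congr_fun this c

theorem bdry_prism (f g : E → E') (c : Chain E) :
    bdry (prism f g c) = prism f g (bdry c) + push f c + push g c := by
  have : bdry.comp (prism f g) = (prism f g).comp bdry + push f + push g :=
    linearMap_ext fun l => by
      induction l with
      | nil => simp [add_self]
      | cons x l ih =>
        simp only [LinearMap.comp_apply, LinearMap.add_apply, push_single] at ih ⊢
        rw [prism_single_cons, map_add, bdry_cone, ih, bdry_single_cons, bdry_single_cons,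
          bdry_single_cons, map_add, map_add (prism f g), prism_cone, ← push_single g l,
          bdry_push]
        simp only [map_add, cone_single, push_single, List.map_cons]
        generalize cone (f x) (cone (g x) (push g (bdry (Finsupp.single l 1)))) = r
        generalize cone (f x) (prism f g (bdry (Finsupp.single l 1))) = s
        generalize prism f g (Finsupp.single l 1) = t
        have h := add_self (Finsupp.single (f x :: l.map g) 1)
        generalize Finsupp.single (f x :: l.map g) (1 : ZMod 2) = a at *
        refine eq_of_sub_eq_zero (Eq.trans ?_ h)
        abel
  exact LinearMap.congr_fun this c

theorem on_prism_single (f g : E → E') (l : List E) :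
    On (fun l' => l'.length = l.length + 1 ∧ ∀ y ∈ l', ∃ x ∈ l, y = f x ∨ y = g x)
      (prism f g (Finsupp.single l 1)) := by
  induction l with
  | nil => rw [prism_single_nil]; exact Submodule.zero_mem _
  | cons x l ih =>
    rw [prism_single_cons]
    refine (on_single ?_).add (ih.map _ fun l' hl' => ?_)
    · simp only [List.length_cons, List.length_map, List.mem_cons, List.mem_map, true_and]
      rintro y (rfl | rfl | ⟨z, hz, rfl⟩)
      exacts [⟨x, .inl rfl, .inl rfl⟩, ⟨x, .inl rfl, .inr rfl⟩, ⟨z, .inr hz, .inr rfl⟩]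
    · rw [cone_single]
      refine on_single ⟨by simp [hl'.1], ?_⟩
      simp only [List.mem_cons]
      rintro y (rfl | hy)
      · exact ⟨x, .inl rfl, .inl rfl⟩
      · obtain ⟨z, hz, h⟩ := hl'.2 y hy
        exact ⟨z, .inr hz, h⟩

/-! ### Products of coboundaries -/

/-- The product `δa (k-1) ∪ ⋯ ∪ δa 0` of coboundaries of `0`-cochains. -/
def cup (a : ℕ → E → ZMod 2) : ℕ → List E → ZMod 2
  | 0, [_] => 1
  | k + 1, x :: y :: l => (a k x + a k y) * cup a k (y :: l)
  | _, _ => 0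

/-- The product `a ∪ φ` of a `0`-cochain with a cochain. -/
def headMul (a : E → ZMod 2) (φ : List E → ZMod 2) : List E → ZMod 2
  | [] => 0
  | x :: l => a x * φ (x :: l)

theorem lift_smul_right (r : ZMod 2) (φ : List E → ZMod 2) (c : Chain E) :
    lift (fun l => r * φ l) c = r * lift φ c := by
  have : lift (fun l => r * φ l) = r • lift φ := linearMap_ext fun l => by simp
  simpa using LinearMap.congr_fun this c

theorem lift_cone (φ : List E → ZMod 2) (x : E) (c : Chain E) :
    lift φ (cone x c) = lift (fun l => φ (x :: l)) c := by
  have : (lift φ).comp (cone x) = lift (fun l => φ (x :: l)) := linearMap_ext fun l => by simp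
  exact LinearMap.congr_fun this c

theorem cup_bdry (a : ℕ → E → ZMod 2) (k : ℕ) (l : List E) :
    lift (cup a k) (bdry (Finsupp.single l 1)) = 0 := by
  induction k generalizing l with
  | zero =>
    rcases l with _ | ⟨x, _ | ⟨y, _ | ⟨z, l⟩⟩⟩
    · simp
    · simp [cup]
    · simp [cup, CharTwo.add_self_eq_zero]
    · have h : (fun l => cup a 0 (x :: y :: l)) = fun _ => 0 * 0 := by
        ext l; simp [cup]
      rw [bdry_single_cons, bdry_single_cons, map_add, map_add, map_add, lift_cone, lift_cone,
        lift_cone, h, lift_smul_right]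
      simp [cup]
  | succ k ih =>
    rcases l with _ | ⟨x, _ | ⟨y, l⟩⟩
    · simp
    · simp [cup]
    · have h : (fun l => cup a (k + 1) (x :: y :: l)) =
          fun l => (a k x + a k y) * cup a k (y :: l) := by
        ext l; simp [cup]
      have ih' := ih (y :: l)
      rw [bdry_single_cons, map_add, lift_single, lift_cone] at ih'
      rw [bdry_single_cons, bdry_single_cons, map_add, map_add, map_add, lift_cone,
        lift_cone, lift_cone, lift_single, lift_single, h, lift_smul_right]
      rcases l with _ | ⟨z, l⟩
      · simp [cup]
      · simp only [cup] at ih' ⊢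
        generalize lift (fun l => cup a k (y :: l)) (bdry (Finsupp.single (z :: l) 1)) = q at *
        have h2 : (2 : ZMod 2) = 0 := rfl
        linear_combination (a k x + a k y) * ih' + a k z * cup a k (z :: l) * h2

theorem headMul_bdry (a : ℕ → E → ZMod 2) (k : ℕ) (c : Chain E) :
    lift (headMul (a k) (cup a k)) (bdry c) = lift (cup a (k + 1)) c := by
  have : (lift (headMul (a k) (cup a k))).comp bdry = lift (cup a (k + 1)) :=
    linearMap_ext fun l => by
      rw [LinearMap.comp_apply, lift_single]
      rcases l with _ | ⟨x, _ | ⟨y, l⟩⟩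
      · simp [cup]
      · simp [cup, headMul]
      · have h := cup_bdry a k (x :: y :: l)
        rw [bdry_single_cons, map_add, lift_single, lift_cone] at h
        rw [bdry_single_cons, map_add, lift_single, lift_cone]
        simp only [headMul, cup]
        rw [lift_smul_right]
        have h2 : (2 : ZMod 2) = 0 := rfl
        linear_combination a k x * h - a k x * cup a k (y :: l) * h2
  exact LinearMap.congr_fun this c

theorem cup_map_neg [Neg E] (a : ℕ → E → ZMod 2) (k : ℕ) (l : List E)
    (h : ∀ x ∈ l, ∀ i, a i (-x) = a i x + 1) : cup a k (l.map (-·)) = cup a k l := by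
  induction k generalizing l with
  | zero => rcases l with _ | ⟨x, _ | ⟨y, l⟩⟩ <;> simp [cup]
  | succ k ih =>
    rcases l with _ | ⟨x, _ | ⟨y, l⟩⟩
    · simp [cup]
    · simp [cup]
    · have := ih (y :: l) fun z hz => h z (by simp_all)
      simp only [List.map_cons, cup] at this ⊢
      rw [this, h x (by simp), h y (by simp)]
      have h2 : (2 : ZMod 2) = 0 := rfl
      linear_combination cup a k (y :: l) * h2

theorem headMul_add_neg [Neg E] (a : ℕ → E → ZMod 2) (k : ℕ) {c : Chain E}
    (hc : On (fun l => ∀ x ∈ l, ∀ i, a i (-x) = a i x + 1) c) :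
    lift (headMul (a k) (cup a k)) (c + push (-·) c) = lift (cup a k) c := by
  refine hc.eq_of_single ((lift (headMul (a k) (cup a k))).comp (LinearMap.id + push (-·)))
    (lift (cup a k)) fun l h => ?_
  rw [LinearMap.comp_apply, LinearMap.add_apply, LinearMap.id_apply, push_single, map_add,
    lift_single, lift_single, lift_single]
  rcases l with _ | ⟨x, l⟩
  · cases k <;> simp [headMul, cup]
  · have := cup_map_neg a k (x :: l) h
    simp only [List.map_cons, headMul] at this ⊢
    rw [this, h x (by simp)]
    have h2 : (2 : ZMod 2) = 0 := rfl
    linear_combination a k x * cup a k (x :: l) * h2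

theorem exists_ne_of_cup_ne_zero (a : ℕ → E → ZMod 2) (k : ℕ) (l : List E) (h : cup a k l ≠ 0)
    (i : ℕ) (hi : i < k) : ∃ x ∈ l, ∃ y ∈ l, a i x ≠ a i y := by
  induction k generalizing l with
  | zero => omega
  | succ k ih =>
    rcases l with _ | ⟨x, _ | ⟨y, l⟩⟩
    · simp [cup] at h
    · simp [cup] at h
    · simp only [cup, mul_ne_zero_iff] at h
      rcases Nat.lt_succ_iff_lt_or_eq.mp hi with hi | rfl
      · obtain ⟨u, hu, v, hv, huv⟩ := ih (y :: l) h.2 hi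
        exact ⟨u, .tail _ hu, v, .tail _ hv, huv⟩
      · refine ⟨x, by simp, y, by simp, fun e => h.1 ?_⟩
        rw [e, CharTwo.add_self_eq_zero]

/-- A cycle that is deformed in finitely many steps to zero is a boundary. -/
theorem bdry_sum_prism (G : ℕ → E → E) (N : ℕ) {z : Chain E} (hz : bdry z = 0) :
    bdry (∑ j ∈ Finset.range N, prism (G j) (G (j + 1)) z) = push (G 0) z + push (G N) z := by
  induction N with
  | zero => simp [add_self]
  | succ N ih =>
    rw [Finset.sum_range_succ, map_add, ih, bdry_prism, hz, map_zero, zero_add]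
    refine eq_of_sub_eq_zero (Eq.trans ?_ (add_self (push (G N) z)))
    abel

end Chain

open Chain

/-! ### Fine chains on the cross-polytope sphere -/

/-- The `k`-dimensional equator of the boundary of the cross-polytope. -/
def equator (m k : ℕ) : Set (Fin (m + 1) → ℝ) :=
  {x | ∑ i, |x i| = 1 ∧ ∀ i : Fin (m + 1), k < i → x i = 0}

/-- A `k`-simplex with vertices in the `k`-dimensional equator and mesh below `δ`. -/
def IsFine (m k : ℕ) (δ : ℝ) (l : List (Fin (m + 1) → ℝ)) : Prop :=
  l.length = k + 1 ∧ (∀ x ∈ l, x ∈ equator m k) ∧ ∀ x ∈ l, ∀ y ∈ l, dist x y < δ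

theorem ne_zero_of_mem_equator {m k : ℕ} {x : Fin (m + 1) → ℝ} (hx : x ∈ equator m k) :
    x ≠ 0 := by
  rintro rfl
  simpa using hx.1

theorem neg_mem_equator {m k : ℕ} {x : Fin (m + 1) → ℝ} (hx : x ∈ equator m k) :
    -x ∈ equator m k :=
  ⟨by simpa using hx.1, fun i hi => by simpa using hx.2 i hi⟩

theorem norm_le_one_of_mem_equator {m k : ℕ} {x : Fin (m + 1) → ℝ} (hx : x ∈ equator m k) :
    ‖x‖ ≤ 1 := by
  rw [pi_norm_le_iff_of_nonneg zero_le_one]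
  intro i
  rw [← hx.1, Real.norm_eq_abs]
  exact Finset.single_le_sum (f := fun i => |x i|) (fun _ _ => abs_nonneg _) (Finset.mem_univ i)

theorem IsFine.neg {m k : ℕ} {δ : ℝ} {l : List (Fin (m + 1) → ℝ)} (h : IsFine m k δ l) :
    IsFine m k δ (l.map (-·)) := by
  refine ⟨by simpa using h.1, ?_, ?_⟩
  · simp only [List.mem_map]
    rintro _ ⟨x, hx, rfl⟩
    exact neg_mem_equator (h.2.1 x hx)
  · simp only [List.mem_map]
    rintro _ ⟨x, hx, rfl⟩ _ ⟨y, hy, rfl⟩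
    rw [dist_neg_neg]
    exact h.2.2 x hx y hy

theorem lineMap_mem_equator {m k : ℕ} (hk : k + 1 < m + 1) {x : Fin (m + 1) → ℝ}
    (hx : x ∈ equator m k) {t : ℝ} (ht : t ∈ Set.Icc (0 : ℝ) 1) :
    AffineMap.lineMap x (Pi.single ⟨k + 1, hk⟩ 1 : Fin (m + 1) → ℝ) t ∈ equator m (k + 1) := by
  have hx' : x ⟨k + 1, hk⟩ = 0 := hx.2 _ (by simp)
  constructor
  · have : ∀ i, |(AffineMap.lineMap x (Pi.single ⟨k + 1, hk⟩ 1 : Fin (m + 1) → ℝ) t) i| =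
        (1 - t) * |x i| + t * (Pi.single ⟨k + 1, hk⟩ 1 : Fin (m + 1) → ℝ) i := by
      intro i
      rw [AffineMap.lineMap_apply_module, Pi.add_apply, Pi.smul_apply, Pi.smul_apply, smul_eq_mul,
        smul_eq_mul]
      rcases eq_or_ne i ⟨k + 1, hk⟩ with rfl | hi
      · simp [hx', abs_of_nonneg ht.1]
      · simp [hi, abs_mul, abs_of_nonneg (sub_nonneg.2 ht.2)]
    rw [Finset.sum_congr rfl fun i _ => this i, Finset.sum_add_distrib, ← Finset.mul_sum,
      ← Finset.mul_sum, hx.1]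
    simp
  · intro i hi
    have hne : i ≠ ⟨k + 1, hk⟩ := by
      rintro rfl
      simp at hi
    simp [AffineMap.lineMap_apply_module, hx.2 i (by omega), hne]

theorem dist_lineMap_le {E : Type*} [NormedAddCommGroup E] [NormedSpace ℝ E] (x y p : E) {t : ℝ}
    (ht : t ∈ Set.Icc (0 : ℝ) 1) :
    dist (AffineMap.lineMap x p t) (AffineMap.lineMap y p t) ≤ dist x y := by
  rw [AffineMap.lineMap_apply_module, AffineMap.lineMap_apply_module, dist_add_right, dist_smul₀,
    Real.norm_eq_abs, abs_of_nonneg (sub_nonneg.2 ht.2)]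
  exact mul_le_of_le_one_left dist_nonneg (by linarith [ht.1])

/-- The cone over a fine symmetric cycle is filled by a fine chain. -/
theorem exists_fine_filling {m k : ℕ} (hk : k + 1 < m + 1) {δ : ℝ} (hδ : 0 < δ)
    {h : Chain (Fin (m + 1) → ℝ)} (hh : On (IsFine m k (δ / 2)) h)
    (hb : bdry (h + push (-·) h) = 0) :
    ∃ h', On (IsFine m (k + 1) δ) h' ∧ bdry h' = h + push (-·) h := by
  obtain ⟨N, hN⟩ := exists_nat_gt (4 / δ)
  have hN0 : (0 : ℝ) < N := lt_trans (by positivity) hN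
  set p : Fin (m + 1) → ℝ := Pi.single ⟨k + 1, hk⟩ 1 with hp
  let G : ℕ → (Fin (m + 1) → ℝ) → (Fin (m + 1) → ℝ) := fun j x => AffineMap.lineMap x p (j / N : ℝ)
  have hG0 : G 0 = id := by ext x; simp [G]
  have hGN : G N = fun _ => p := by ext x; simp [G, div_self hN0.ne']
  have hz : On (IsFine m k (δ / 2)) (h + push (-·) h) :=
    hh.add (hh.map _ fun l hl => by rw [push_single]; exact on_single hl.neg)
  refine ⟨∑ j ∈ Finset.range N, prism (G j) (G (j + 1)) (h + push (-·) h),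
    on_sum fun j hj => hz.map _ fun l hl => (on_prism_single _ _ l).mono fun l' hl' => ?_, ?_⟩
  · have hj' : (j : ℝ) + 1 ≤ N := by exact_mod_cast Finset.mem_range.1 hj
    have ht0 : (j / N : ℝ) ∈ Set.Icc (0 : ℝ) 1 := ⟨by positivity, by rw [div_le_one hN0]; linarith⟩
    have ht1 : ((j + 1 : ℕ) / N : ℝ) ∈ Set.Icc (0 : ℝ) 1 :=
      ⟨by positivity, by rw [div_le_one hN0]; push_cast; linarith⟩
    have hstep : ∀ x ∈ equator m k, dist (G j x) (G (j + 1) x) < δ / 2 := by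
      intro x hx
      have hd : dist x p ≤ 2 := by
        rw [dist_eq_norm]
        refine (norm_sub_le _ _).trans ?_
        have : ‖p‖ ≤ 1 := by rw [hp, Pi.norm_single, norm_one]
        linarith [norm_le_one_of_mem_equator hx]
      have ht : dist (j / N : ℝ) ((j + 1 : ℕ) / N : ℝ) = 1 / N := by
        rw [Real.dist_eq, abs_sub_comm, abs_of_nonneg]
        · push_cast; ring
        · push_cast; rw [add_div]; linarith [one_div_pos.2 hN0]
      rw [dist_lineMap_lineMap, ht]
      have : 4 < δ * N := by rwa [div_lt_iff₀' hδ] at hN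
      calc 1 / (N : ℝ) * dist x p ≤ 1 / N * 2 := by gcongr
        _ < δ / 2 := by rw [div_mul_eq_mul_div, div_lt_iff₀ hN0]; linarith
    refine ⟨by rw [hl'.1, hl.1], fun y hy => ?_, fun y hy y' hy' => ?_⟩
    · obtain ⟨x, hx, rfl | rfl⟩ := hl'.2 y hy
      exacts [lineMap_mem_equator hk (hl.2.1 x hx) ht0, lineMap_mem_equator hk (hl.2.1 x hx) ht1]
    · obtain ⟨x, hx, hxy⟩ := hl'.2 y hy
      obtain ⟨x', hx', hxy'⟩ := hl'.2 y' hy'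
      have h0 := (dist_lineMap_le x x' p ht0).trans_lt (hl.2.2 x hx x' hx')
      have h1 := (dist_lineMap_le x x' p ht1).trans_lt (hl.2.2 x hx x' hx')
      have hs := hstep x' (hl.2.1 x' hx')
      have hs' := hstep x (hl.2.1 x hx)
      change dist (G j x) (G j x') < _ at h0
      change dist (G (j + 1) x) (G (j + 1) x') < _ at h1
      rcases hxy with rfl | rfl <;> rcases hxy' with rfl | rfl
      · linarith
      · linarith [dist_triangle (G j x) (G j x') (G (j + 1) x')]
      · rw [dist_comm] at hs
        linarith [dist_triangle (G (j + 1) x) (G (j + 1) x') (G j x')]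
      · linarith
  · have h0 : push (G 0) (h + push (-·) h) = h + push (-·) h := by
      have : push (G 0) = LinearMap.id := linearMap_ext fun l => by simp [hG0]
      rw [this, LinearMap.id_apply]
    have h1 : push (G N) (h + push (-·) h) = 0 := by
      rw [map_add, push_push, hGN]
      exact add_self _
    rw [bdry_sum_prism G N hb, h0, h1, add_zero]

/-- Fine hemispheres on which the product of the coboundaries of odd `0`-cochains is nonzero. -/
theorem exists_fine_hemisphere {m : ℕ} (a : ℕ → (Fin (m + 1) → ℝ) → ZMod 2)
    (ha : ∀ i x, x ≠ 0 → a i (-x) = a i x + 1) (k : ℕ) (hk : k ≤ m) {δ : ℝ} (hδ : 0 < δ) :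
    ∃ h, On (IsFine m k δ) h ∧ bdry (h + push (-·) h) = 0 ∧ lift (cup a k) h = 1 := by
  induction k generalizing δ with
  | zero =>
    refine ⟨Finsupp.single [Pi.single 0 1] 1, on_single ⟨rfl, ?_, ?_⟩, ?_, ?_⟩
    · simp only [List.mem_singleton, forall_eq]
      refine ⟨?_, fun i hi => ?_⟩
      · rw [Finset.sum_eq_single 0] <;> simp +contextual
      · have : i ≠ 0 := by rintro rfl; simp at hi
        simp [this]
    · simpa using hδ
    · simp [add_self]
    · simp [cup]
  | succ k ih =>
    obtain ⟨h, hh, hb, hc⟩ := ih (by omega) (half_pos hδ)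
    obtain ⟨h', hh', hb'⟩ := exists_fine_filling (by omega) hδ hh hb
    refine ⟨h', hh', ?_, ?_⟩
    · have hid : ((-·) : (Fin (m + 1) → ℝ) → _) ∘ (-·) = id := by ext; simp
      have : push (id : (Fin (m + 1) → ℝ) → _) = LinearMap.id := linearMap_ext fun l => by simp
      rw [map_add, bdry_push, hb', map_add, push_push, hid, this, LinearMap.id_apply,
        add_comm (push _ h) h, add_self]
    · rw [← headMul_bdry, hb', headMul_add_neg, hc]
      exact hh.mono fun l hl x hx i => ha i x (ne_zero_of_mem_equator (hl.2.1 x hx))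

/-! ### The Borsuk–Ulam theorem -/

open Classical in
/-- The sign of `g x` as an element of `ZMod 2`, with zeros resolved in an odd way. -/
noncomputable def oddSign {E : Type*} [Neg E] (g : E → ℝ) (x : E) : ZMod 2 :=
  if 0 < g x ∨ g x = 0 ∧ WellOrderingRel x (-x) then 1 else 0

theorem oddSign_neg {E : Type*} [AddCommGroup E] [IsAddTorsionFree E] {g : E → ℝ}
    (hg : ∀ x, g (-x) = -g x) {x : E} (hx : x ≠ 0) : oddSign g (-x) = oddSign g x + 1 := by
  have h11 : (1 : ZMod 2) + 1 = 0 := rfl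
  have hne : x ≠ -x := fun h => hx (self_eq_neg.1 h)
  unfold oddSign
  rw [hg, neg_neg]
  rcases lt_trichotomy (g x) 0 with h | h | h
  · simp [h, h.not_gt, h.ne]
  · rcases trichotomous_of WellOrderingRel x (-x) with h' | h' | h'
    · simp [h, h', asymm_of WellOrderingRel h', h11]
    · exact absurd h' hne
    · simp [h, h', asymm_of WellOrderingRel h']
  · simp [h, h.not_gt, h.ne', h11]

theorem oddSign_eq {E : Type*} [Neg E] {g : E → ℝ} {x y : E} {ε : ℝ}
    (hx : ε ≤ |g x|) (hxy : |g x - g y| < ε) : oddSign g x = oddSign g y := by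
  unfold oddSign
  rw [abs_lt] at hxy
  rcases le_abs.1 hx with h | h
  · rw [if_pos (.inl (by linarith)), if_pos (.inl (by linarith))]
  · rw [if_neg, if_neg]
    · rintro (h' | ⟨h', -⟩) <;> linarith
    · rintro (h' | ⟨h', -⟩) <;> linarith

/-- The Borsuk–Ulam theorem: an odd continuous map `ℝᵐ⁺¹ → ℝᵐ` has a nontrivial zero. -/
theorem exists_ne_zero_of_odd {m : ℕ} (f : (Fin (m + 1) → ℝ) → Fin m → ℝ) (hf : Continuous f)
    (hodd : ∀ x, f (-x) = -f x) : ∃ x ≠ 0, f x = 0 := by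
  by_contra! hne
  have hK : IsCompact (equator m m) := by
    refine Metric.isCompact_of_isClosed_isBounded ?_ ?_
    · have : equator m m = {x | ∑ i, |x i| = 1} := by
        ext x
        refine ⟨And.left, fun h => ⟨h, fun i hi => ?_⟩⟩
        omega
      rw [this]
      exact isClosed_eq (by fun_prop) (by fun_prop)
    · exact isBounded_iff_forall_norm_le.2 ⟨1, fun x hx => norm_le_one_of_mem_equator hx⟩
  obtain ⟨ε, hε, hmin⟩ : ∃ ε > 0, ∀ x ∈ equator m m, 2 * ε ≤ ‖f x‖ := by
    rcases (equator m m).eq_empty_or_nonempty with he | hne'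
    · exact ⟨1, one_pos, by simp [he]⟩
    · obtain ⟨x₀, hx₀, h⟩ := hK.exists_isMinOn hne' hf.norm.continuousOn
      refine ⟨‖f x₀‖ / 2, half_pos (norm_pos_iff.2 (hne x₀ (ne_zero_of_mem_equator hx₀))),
        fun x hx => ?_⟩
      have := isMinOn_iff.1 h x hx
      linarith
  obtain ⟨δ, hδ, huc⟩ := Metric.uniformContinuousOn_iff.1
    (hK.uniformContinuousOn_of_continuous hf.continuousOn) ε hε
  let a : ℕ → (Fin (m + 1) → ℝ) → ZMod 2 :=
    fun i => oddSign fun x => if h : i < m then f x ⟨i, h⟩ else x 0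
  obtain ⟨h, hh, -, h1⟩ := exists_fine_hemisphere a
    (fun i x hx => oddSign_neg (fun y => by split_ifs <;> simp [hodd]) hx) m le_rfl hδ
  have h0 : lift (cup a m) h = 0 := by
    refine (hh.eq_of_single (lift (cup a m)) 0 fun l hl => ?_).trans (by simp)
    rw [lift_single, LinearMap.zero_apply]
    by_contra hc
    obtain ⟨x, hx⟩ : ∃ x, x ∈ l :=
      List.exists_mem_of_length_pos (by rw [hl.1]; omega)
    refine (hmin x (hl.2.1 x hx)).not_gt ((pi_norm_lt_iff (by linarith)).2 fun i => ?_)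
    obtain ⟨y, hy, z, hz, hyz⟩ := exists_ne_of_cup_ne_zero a m l hc i i.2
    have hd : ∀ u ∈ l, ∀ v ∈ l, |f u i - f v i| < ε := fun u hu v hv =>
      (dist_le_pi_dist (f u) (f v) i).trans_lt
        (huc u (hl.2.1 u hu) v (hl.2.1 v hv) (hl.2.2 u hu v hv))
    have hy' : |f y i| < ε := by
      by_contra! hge
      exact hyz (oddSign_eq (ε := ε) (by simpa using hge) (by simpa using hd y hy z hz))
    have := hd x hx y hy
    rw [Real.norm_eq_abs]
    rw [abs_lt] at *
    constructor <;> linarith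
  exact one_ne_zero (h1.symm.trans h0)

/-! ### Support functions and halving hyperplanes -/

theorem continuous_upperSupport {n : ℕ} {X : Set (EuclideanSpace ℝ (Fin n))} (hX : IsCompact X) :
    Continuous fun u => upperSupport u X :=
  hX.continuous_sSup (f := fun u x => inner ℝ u x) continuous_inner

theorem continuous_lowerSupport {n : ℕ} {X : Set (EuclideanSpace ℝ (Fin n))} (hX : IsCompact X) :
    Continuous fun u => lowerSupport u X :=
  hX.continuous_sInf (f := fun u x => inner ℝ u x) continuous_inner

theorem upperSupport_neg {n : ℕ} (u : EuclideanSpace ℝ (Fin n))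
    (X : Set (EuclideanSpace ℝ (Fin n))) : upperSupport (-u) X = -lowerSupport u X := by
  rw [upperSupport, lowerSupport, Real.sInf_def, neg_neg]
  congr 1
  ext r
  simp [neg_eq_iff_eq_neg]

theorem lowerSupport_neg {n : ℕ} (u : EuclideanSpace ℝ (Fin n))
    (X : Set (EuclideanSpace ℝ (Fin n))) : lowerSupport (-u) X = -upperSupport u X := by
  have := upperSupport_neg (-u) X
  rw [neg_neg] at this
  rw [this, neg_neg]

open scoped Pointwise in
theorem image_inner_smul {n : ℕ} (r : ℝ) (u : EuclideanSpace ℝ (Fin n))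
    (X : Set (EuclideanSpace ℝ (Fin n))) :
    (fun x => inner ℝ (r • u) x) '' X = r • ((fun x => (inner ℝ u x : ℝ)) '' X) := by
  rw [← Set.image_smul, Set.image_image]
  simp [inner_smul_left]

theorem upperSupport_smul {n : ℕ} {r : ℝ} (hr : 0 ≤ r) (u : EuclideanSpace ℝ (Fin n))
    (X : Set (EuclideanSpace ℝ (Fin n))) : upperSupport (r • u) X = r * upperSupport u X := by
  rw [upperSupport, image_inner_smul, Real.sSup_smul_of_nonneg hr, smul_eq_mul, upperSupport]

theorem lowerSupport_smul {n : ℕ} {r : ℝ} (hr : 0 ≤ r) (u : EuclideanSpace ℝ (Fin n))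
    (X : Set (EuclideanSpace ℝ (Fin n))) : lowerSupport (r • u) X = r * lowerSupport u X := by
  rw [lowerSupport, image_inner_smul, Real.sInf_smul_of_nonneg hr, smul_eq_mul, lowerSupport]

/-- A hyperplane halfway between the two supporting hyperplanes of a convex body cuts it into two
parts of equal width. -/
theorem halving_of_add_eq_two_mul {n : ℕ} {A : Set (EuclideanSpace ℝ (Fin n))} (hA : IsCompact A)
    (hconv : Convex ℝ A) (hne : A.Nonempty) (U : EuclideanSpace ℝ (Fin (n + 1)))
    (h : upperSupport (normal U) A + lowerSupport (normal U) A = 2 * level U) :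
    (A ∩ upperHalf U).Nonempty ∧ (A ∩ lowerHalf U).Nonempty ∧
      upperSupport (normal U) (A ∩ upperHalf U) - lowerSupport (normal U) (A ∩ upperHalf U)
        = upperSupport (normal U) (A ∩ lowerHalf U)
          - lowerSupport (normal U) (A ∩ lowerHalf U) := by
  have hup := isGreatest_upperSupport (normal U) hA hne
  have hlo := isLeast_lowerSupport (normal U) hA hne
  obtain ⟨p, hpA, hp⟩ := hup.1
  obtain ⟨q, hqA, hq⟩ := hlo.1
  have hle : lowerSupport (normal U) A ≤ upperSupport (normal U) A := hlo.2 hup.1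
  obtain ⟨c, hcA, hc⟩ : level U ∈ (fun x => (inner ℝ (normal U) x : ℝ)) '' A :=
    hconv.isPreconnected.intermediate_value hqA hpA (by fun_prop)
      ⟨by simp only at hq; linarith, by simp only at hp; linarith⟩
  simp only at hp hq hc
  have hcu : c ∈ A ∩ upperHalf U := ⟨hcA, hc.ge⟩
  have hcl : c ∈ A ∩ lowerHalf U := ⟨hcA, hc.le⟩
  have h1 : upperSupport (normal U) (A ∩ upperHalf U) = upperSupport (normal U) A :=
    IsGreatest.csSup_eq ⟨⟨p, ⟨hpA, by rw [upperHalf, Set.mem_ofPred_eq]; linarith⟩, hp⟩,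
      fun _ hr => hup.2 (Set.image_mono Set.inter_subset_left hr)⟩
  have h2 : lowerSupport (normal U) (A ∩ upperHalf U) = level U :=
    IsLeast.csInf_eq ⟨⟨c, hcu, hc⟩, by rintro _ ⟨x, hx, rfl⟩; exact hx.2⟩
  have h3 : upperSupport (normal U) (A ∩ lowerHalf U) = level U :=
    IsGreatest.csSup_eq ⟨⟨c, hcl, hc⟩, by rintro _ ⟨x, hx, rfl⟩; exact hx.2⟩
  have h4 : lowerSupport (normal U) (A ∩ lowerHalf U) = lowerSupport (normal U) A :=
    IsLeast.csInf_eq ⟨⟨q, ⟨hqA, by rw [lowerHalf, Set.mem_ofPred_eq]; linarith⟩, hq⟩,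
      fun _ hr => hlo.2 (Set.image_mono Set.inter_subset_left hr)⟩
  refine ⟨⟨c, hcu⟩, ⟨c, hcl⟩, ?_⟩
  rw [h1, h2, h3, h4]
  linarith

/-- Some direction in which the midpoints of the projections of the bodies coincide. -/
theorem exists_common_midpoint {m : ℕ} (A : Fin (m + 1) → Set (EuclideanSpace ℝ (Fin (m + 1))))
    (hA : ∀ i, IsCompact (A i)) :
    ∃ u ≠ 0, ∃ c : ℝ, ∀ i, upperSupport u (A i) + lowerSupport u (A i) = 2 * c := by
  let g : Fin (m + 1) → EuclideanSpace ℝ (Fin (m + 1)) → ℝ :=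
    fun i u => upperSupport u (A i) + lowerSupport u (A i)
  have hg : ∀ i, Continuous (g i) := fun i =>
    (continuous_upperSupport (hA i)).add (continuous_lowerSupport (hA i))
  have hneg : ∀ i u, g i (-u) = -g i u := fun i u => by
    simp only [g, upperSupport_neg, lowerSupport_neg]
    ring
  obtain ⟨x, hx, h⟩ := exists_ne_zero_of_odd
    (fun x i => g i.castSucc (WithLp.toLp 2 x) - g (Fin.last m) (WithLp.toLp 2 x))
    (continuous_pi fun i => ((hg _).comp (PiLp.continuous_toLp 2 _)).sub
      ((hg _).comp (PiLp.continuous_toLp 2 _)))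
    (fun x => by
      ext i
      simp only [WithLp.toLp_neg, hneg, Pi.neg_apply]
      ring)
  refine ⟨WithLp.toLp 2 x, by simpa using hx, g (Fin.last m) (WithLp.toLp 2 x) / 2, fun i => ?_⟩
  change g i _ = _
  rw [mul_div_cancel₀ _ two_ne_zero]
  induction i using Fin.lastCases with
  | last => rfl
  | cast i => exact sub_eq_zero.1 (congrFun h i)

end BUOpt

theorem mainTheorem1 (n : ℕ) (A : Fin n → Set (EuclideanSpace ℝ (Fin n)))
    (hcompact : ∀ i, IsCompact (A i)) (hconvex : ∀ i, Convex ℝ (A i))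
    (hint : ∀ i, (interior (A i)).Nonempty) :
    ∃ U ∈ Metric.sphere (0 : EuclideanSpace ℝ (Fin (n + 1))) 1, ∀ i,
      (A i ∩ BUOpt.upperHalf U).Nonempty ∧ (A i ∩ BUOpt.lowerHalf U).Nonempty ∧
      BUOpt.upperSupport (BUOpt.normal U) (A i ∩ BUOpt.upperHalf U)
          - BUOpt.lowerSupport (BUOpt.normal U) (A i ∩ BUOpt.upperHalf U)
        = BUOpt.upperSupport (BUOpt.normal U) (A i ∩ BUOpt.lowerHalf U)
          - BUOpt.lowerSupport (BUOpt.normal U) (A i ∩ BUOpt.lowerHalf U) := by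
  rcases n with _ | m
  · exact ⟨EuclideanSpace.single 0 1, by simp, fun i => i.elim0⟩
  obtain ⟨u, hu, c, hc⟩ := BUOpt.exists_common_midpoint A hcompact
  let V : EuclideanSpace ℝ (Fin (m + 1 + 1)) := WithLp.toLp 2 (Fin.snoc (fun j => u j) c)
  have hV : V ≠ 0 := by
    intro h
    refine hu ?_
    ext j
    have := congrArg (fun W : EuclideanSpace ℝ (Fin (m + 1 + 1)) => W j.castSucc) h
    simpa [V] using this
  have hr : 0 ≤ ‖V‖⁻¹ := by positivity
  have hn : BUOpt.normal (‖V‖⁻¹ • V) = ‖V‖⁻¹ • u := by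
    ext j
    simp [BUOpt.normal, V]
  have hl : BUOpt.level (‖V‖⁻¹ • V) = ‖V‖⁻¹ * c := by
    simp [BUOpt.level, V]
  refine ⟨‖V‖⁻¹ • V, by simp [norm_smul, hV], fun i =>
    BUOpt.halving_of_add_eq_two_mul (hcompact i) (hconvex i) ((hint i).mono interior_subset) _ ?_⟩
  rw [hn, hl, BUOpt.upperSupport_smul hr, BUOpt.lowerSupport_smul hr, ← mul_add, hc i]
  ring
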